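/- Let $E$ be a finite set with at least two elements and let $A=(A(x,y))_{x,y\in E}$ be the generator of a continuous-time Markov process on $E$ (that is, $A(x,y)\ge 0$ for $x\ne y$ and $\sum_{y}A(x,y)=0$ for every $x$), with jump rates $a(x)=-A(x,x)$. Assume that the transition matrix $P$ of the embedded chain, $P(x,y)=-A(x,y)/A(x,x)$ for $x\neq y$ and $P(x,x)=0$, is irreducible (hence recurrent, $E$ being finite), and let $\mu$ be the invariant probability measure of the process, $\mu A=0$. Let $\lambda:E\to\mathbb R$, let $\Lambda$ be the diagonal matrix with diagonal $(\lambda(x))_{x\in E}$, and put $\underline\lambda=\min_{x\in E}\lambda(x)$. For $p\in\mathbb R$ let $A_p=A-p\Lambda$ and $$\eta_p=-\max_{\gamma\in\mathrm{Spec}(A_p)}\mathrm{Re}\,\gamma ,$$ where $\mathrm{Spec}(A_p)\subset\mathbb C$ is the set of complex eigenvalues of $A_p$. 1. The function $p\mapsto\eta_p$ is smooth ($C^\infty$) and concave on $\mathbb R_+=[0,\infty)$. Its derivative at $p=0$ is $\sum_{x\in E}\lambda(x)\mu(x)$, and $\eta_p/p\to\underline\lambda$ as $p\to+\infty$. 2.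 Assume in addition that $\sum_{x\in E}\lambda(x)\mu(x)>0$. Then: - if $\underline\lambda\ge 0$, then $\eta_p>0$ for all $p>0$; - if $\underline\lambda<0$, there is a unique $\kappa\in\bigl(0,\min\{-a(x)/\lambda(x):\ x\in E,\ \lambda(x)<0\}\bigr)$ such that $\eta_p>0$ for all $p$ with $0<p<\kappa$, and $\eta_p<0$ for all $p>\kappa$. -/

import Mathlib

open Set Filter Topology
open scoped ContDiff

namespace SwitchedOU

/-- `A` is the infinitesimal generator (Q-matrix) of a continuous time Markov chain on the finite
set `E`: nonnegative off-diagonal entries and zero row sums. -/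
structure IsGenerator {E : Type*} [Fintype E] (A : Matrix E E ℝ) : Prop where
  offDiag_nonneg : ∀ x y, x ≠ y → 0 ≤ A x y
  row_sum_eq_zero : ∀ x, ∑ y, A x y = 0

/-- The jump rate `a(x) = -A(x,x)`. -/
def jumpRate {E : Type*} (A : Matrix E E ℝ) (x : E) : ℝ := -A x x

/-- The transition matrix `P` of the embedded jump chain: `P(x,y) = -A(x,y) / A(x,x)` for `x ≠ y`
and `P(x,x) = 0`. If `E` has at least two points and `A(x,x) = 0` for some `x`, then the row of `x`
vanishes and `P` is not irreducible. -/
noncomputable def embeddedChain {E : Type*} [DecidableEq E] (A : Matrix E E ℝ) : Matrix E E ℝ :=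
  Matrix.of fun x y => if x = y then 0 else -A x y / A x x

/-- `μ` is an invariant probability measure of the Markov process with generator `A`, written as a
row vector: `μ A = 0`. -/
def IsInvariantProbability {E : Type*} [Fintype E] (A : Matrix E E ℝ) (μ : E → ℝ) : Prop :=
  μ ∈ stdSimplex ℝ E ∧ Matrix.vecMul μ A = 0

/-- The matrix `A_p = A - p Λ`, where `Λ` is the diagonal matrix with diagonal `lam`. -/
def tilted {E : Type*} [DecidableEq E] (A : Matrix E E ℝ) (lam : E → ℝ) (p : ℝ) : Matrix E E ℝ :=
  A - p • Matrix.diagonal lam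

/-- The real parts of the complex eigenvalues of `A_p`. -/
def spectralReals {E : Type*} [Fintype E] [DecidableEq E] (A : Matrix E E ℝ) (lam : E → ℝ)
    (p : ℝ) : Set ℝ :=
  Complex.re '' spectrum ℂ ((tilted A lam p).map (algebraMap ℝ ℂ))

/-- `η_p = - max {Re γ : γ ∈ Spec(A_p)}`; the supremum is a maximum by
`isGreatest_spectralReals`. -/
noncomputable def eta {E : Type*} [Fintype E] [DecidableEq E] (A : Matrix E E ℝ) (lam : E → ℝ)
    (p : ℝ) : ℝ :=
  -sSup (spectralReals A lam p)

theorem isGreatest_spectralReals {E : Type*} [Fintype E] [DecidableEq E] [Nonempty E]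
    (A : Matrix E E ℝ) (lam : E → ℝ) (p : ℝ) :
    IsGreatest (spectralReals A lam p) (-eta A lam p) := by
  have hne : (spectralReals A lam p).Nonempty :=
    (spectrum.nonempty_of_isAlgClosed_of_finiteDimensional ℂ _).image _
  have hfin : (spectralReals A lam p).Finite := (Matrix.finite_spectrum _).image _
  rw [eta, neg_neg]
  exact ⟨hne.csSup_mem hfin, fun _ h => le_csSup hfin.bddAbove h⟩

/-- The minimum of `lam` over the finite nonempty set `E`. -/
noncomputable def minRate {E : Type*} [Fintype E] [Nonempty E] (lam : E → ℝ) : ℝ :=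
  Finset.univ.inf' Finset.univ_nonempty lam

/-- `min {-a(x)/lam(x) : lam(x) < 0}`; the infimum is a minimum as soon as `lam` takes a negative
value, by `isLeast_criticalBound`. -/
noncomputable def criticalBound {E : Type*} (A : Matrix E E ℝ) (lam : E → ℝ) : ℝ :=
  sInf ((fun x => -jumpRate A x / lam x) '' {x | lam x < 0})

theorem isLeast_criticalBound {E : Type*} [Fintype E] [Nonempty E] (A : Matrix E E ℝ)
    (lam : E → ℝ) (h : minRate lam < 0) :
    IsLeast ((fun x => -jumpRate A x / lam x) '' {x | lam x < 0}) (criticalBound A lam) := by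
  obtain ⟨x, -, hx⟩ := (Finset.inf'_lt_iff _).1 h
  have hfin : ((fun x => -jumpRate A x / lam x) '' {x | lam x < 0}).Finite :=
    (Set.toFinite _).image _
  exact ⟨(Set.Nonempty.image _ ⟨x, hx⟩).csInf_mem hfin, fun _ h => csInf_le hfin.bddBelow h⟩

end SwitchedOU

/-! Tilting changes only the diagonal, so every `A_p` is an irreducible Metzler matrix and has a
positive eigenvector (`exists_pos_eigenvector`). Its eigenvalue bounds the real part of the whole
spectrum, hence equals `-η_p` (`eta_eq_neg`), and each claim becomes a statement about this Perron
pair. The eigenvalue is simple, so the implicit function theorem gives smoothness. Geometric means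
of positive eigenvectors are supersolutions, which gives concavity. Pairing the eigenvector equation
with `μ` gives the derivative at `0`. The bounds `p * minRate lam ≤ η_p < a(x) + p * lam x` give the
slope at infinity.

The signs then follow from concavity: `η` starts at `0` with positive slope. It stays positive if
`minRate lam ≥ 0`; otherwise the upper bound makes it negative at `criticalBound`, and a concave
function that has been positive cannot return to nonnegative values after a zero. -/

namespace SwitchedOU

open Matrix

/-! ### Perron theory for irreducible Metzler matrices -/

section Perron

variable {n : Type*} [Fintype n]

/-- A real square matrix with nonnegative off-diagonal entries whose graph of positive off-diagonal
entries is strongly connected: a nonempty set of indices closed under its edges is everything. -/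
structure IsIrreducibleMetzler {n : Type*} (M : Matrix n n ℝ) : Prop where
  offDiag_nonneg : ∀ i j, i ≠ j → 0 ≤ M i j
  eq_univ_of_closed : ∀ Z : Set n, Z.Nonempty →
    (∀ i ∈ Z, ∀ j, i ≠ j → 0 < M i j → j ∈ Z) → Z = univ

namespace IsIrreducibleMetzler

variable {M : Matrix n n ℝ}

theorem mul_nonneg_of_apply_eq_zero {n : Type*} {M : Matrix n n ℝ}
    (hM : IsIrreducibleMetzler M) {u : n → ℝ} (hu : ∀ i, 0 ≤ u i)
    {i : n} (hi : u i = 0) (j : n) : 0 ≤ M i j * u j := by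
  rcases eq_or_ne i j with rfl | hij
  · simp [hi]
  · exact mul_nonneg (hM.offDiag_nonneg i j hij) (hu j)

/-- The diagonal entry, whose sign is unknown, is multiplied by zero. The comparison arguments below
apply this to `m • v - h`, with `m` the largest ratio, at an index of contact. -/
theorem mulVec_nonneg_of_apply_eq_zero (hM : IsIrreducibleMetzler M) {u : n → ℝ}
    (hu : ∀ i, 0 ≤ u i) {i : n} (hi : u i = 0) : 0 ≤ (M *ᵥ u) i :=
  Finset.sum_nonneg fun j _ => hM.mul_nonneg_of_apply_eq_zero hu hi j

/-- Strong maximum principle. -/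
theorem eq_zero_of_mulVec_le (hM : IsIrreducibleMetzler M) {u : n → ℝ} {t : ℝ}
    (hu : ∀ i, 0 ≤ u i) (hle : ∀ i, (M *ᵥ u) i ≤ t * u i) {i : n} (hi : u i = 0) : u = 0 := by
  have hZ : {i | u i = 0} = univ := by
    refine hM.eq_univ_of_closed _ ⟨i, hi⟩ fun k (hk : u k = 0) j _ hpos => ?_
    have h0 : ∑ j, M k j * u j = 0 := by
      refine le_antisymm ?_ (Finset.sum_nonneg fun j _ => hM.mul_nonneg_of_apply_eq_zero hu hk j)
      simpa [hk, mulVec, dotProduct] using hle k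
    have := (Finset.sum_eq_zero_iff_of_nonneg
      fun j _ => hM.mul_nonneg_of_apply_eq_zero hu hk j).1 h0 j (Finset.mem_univ j)
    exact (mul_eq_zero.1 this).resolve_left hpos.ne'
  funext j
  exact (hZ ▸ mem_univ j : j ∈ {i | u i = 0})

/-- The largest ratio `h i / v i` is attained. -/
theorem exists_ratio_max [Nonempty n] (h : n → ℝ) {v : n → ℝ} (hv : ∀ i, 0 < v i) :
    ∃ m i, (∀ j, h j ≤ m * v j) ∧ h i = m * v i := by
  obtain ⟨i, -, hi⟩ := Finset.exists_max_image Finset.univ (fun i => h i / v i)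
    Finset.univ_nonempty
  refine ⟨h i / v i, i, fun j => ?_, (div_mul_cancel₀ _ (hv i).ne').symm⟩
  exact (div_le_iff₀ (hv j)).1 (hi j (Finset.mem_univ j))

/-- Comparison of a positive eigenvector with a positive supersolution. -/
theorem le_of_mulVec_le [Nonempty n] (hM : IsIrreducibleMetzler M) {v u : n → ℝ} {r t : ℝ}
    (hv : ∀ i, 0 < v i) (hMv : M *ᵥ v = r • v) (hu : ∀ i, 0 < u i)
    (hMu : ∀ i, (M *ᵥ u) i ≤ t * u i) : r ≤ t := by
  obtain ⟨m, i, hle, hi⟩ := exists_ratio_max v hu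
  have hm : 0 < m := pos_of_mul_pos_left (hi ▸ hv i) (hu i).le
  have h0 := hM.mulVec_nonneg_of_apply_eq_zero (u := m • u - v) (i := i)
    (fun j => by simpa using hle j) (by simp [hi])
  rw [mulVec_sub, mulVec_smul, hMv] at h0
  simp only [Pi.sub_apply, Pi.smul_apply, smul_eq_mul] at h0
  have h1 := mul_le_mul_of_nonneg_left (hMu i) hm.le
  have h2 : m * (t * u i) = t * v i := by rw [hi]; ring
  exact le_of_mul_le_mul_right (by linarith) (hv i)

theorem nonpos_of_mulVec_sub_eq [Nonempty n] (hM : IsIrreducibleMetzler M) {v h : n → ℝ}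
    {r s : ℝ} (hv : ∀ i, 0 < v i) (hMv : M *ᵥ v = r • v) (hh : M *ᵥ h - r • h = s • v) :
    s ≤ 0 := by
  obtain ⟨m, i, hle, hi⟩ := exists_ratio_max h hv
  have h0 := hM.mulVec_nonneg_of_apply_eq_zero (u := m • v - h) (i := i)
    (fun j => by simpa using hle j) (by simp [hi])
  rw [mulVec_sub, mulVec_smul, hMv, sub_eq_iff_eq_add.1 hh] at h0
  simp only [Pi.sub_apply, Pi.add_apply, Pi.smul_apply, smul_eq_mul, hi] at h0
  by_contra! hs
  nlinarith [mul_pos hs (hv i)]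

/-- A positive eigenvector spans a simple eigenspace: it lies outside the range of `M - r`, whose
kernel it spans. -/
theorem eq_smul_of_mulVec_sub_eq [Nonempty n] (hM : IsIrreducibleMetzler M) {v h : n → ℝ}
    {r s : ℝ} (hv : ∀ i, 0 < v i) (hMv : M *ᵥ v = r • v) (hh : M *ᵥ h - r • h = s • v) :
    s = 0 ∧ ∃ m : ℝ, h = m • v := by
  have hs : s = 0 := by
    refine le_antisymm (hM.nonpos_of_mulVec_sub_eq hv hMv hh) ?_
    have := hM.nonpos_of_mulVec_sub_eq (h := -h) (s := -s) hv hMv (by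
      rw [mulVec_neg, smul_neg, neg_smul, ← hh]; abel)
    linarith
  subst hs
  refine ⟨rfl, ?_⟩
  obtain ⟨m, i, hle, hi⟩ := exists_ratio_max h hv
  refine ⟨m, ?_⟩
  rw [zero_smul, sub_eq_zero] at hh
  have := hM.eq_zero_of_mulVec_le (u := m • v - h) (t := r) (i := i)
    (fun j => by simpa using hle j) (fun j => le_of_eq (by
      rw [mulVec_sub, mulVec_smul, hMv, hh]
      simp only [Pi.sub_apply, Pi.smul_apply, smul_eq_mul]; ring)) (by simp [hi])
  exact (sub_eq_zero.1 this).symm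

/-- Gershgorin-type bound relative to a positive eigenvector. -/
theorem re_le_of_mem_spectrum [DecidableEq n] [Nonempty n] (hM : IsIrreducibleMetzler M)
    {v : n → ℝ} {r : ℝ} (hv : ∀ i, 0 < v i) (hMv : M *ᵥ v = r • v) {γ : ℂ}
    (hγ : γ ∈ spectrum ℂ (M.map (algebraMap ℝ ℂ))) : γ.re ≤ r := by
  rw [← Matrix.spectrum_toLin', ← Module.End.hasEigenvalue_iff_mem_spectrum] at hγ
  obtain ⟨u, hu⟩ := hγ.exists_hasEigenvector
  have heq := hu.apply_eq_smul
  rw [Matrix.toLin'_apply] at heq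
  obtain ⟨m, i, hle, hi⟩ := exists_ratio_max (fun j => ‖u j‖) hv
  have hm : 0 < m := by
    obtain ⟨j, hj⟩ := Function.ne_iff.1 hu.2
    exact pos_of_mul_pos_left ((norm_pos_iff.2 hj).trans_le (hle j)) (hv j).le
  have hpos : 0 < m * v i := mul_pos hm (hv i)
  have h1 := congrFun heq i
  simp only [mulVec, dotProduct, map_apply, Complex.coe_algebraMap, Pi.smul_apply,
    smul_eq_mul] at h1
  rw [← Finset.add_sum_erase _ _ (Finset.mem_univ i)] at h1
  have h2 : (γ - M i i) * u i = ∑ j ∈ Finset.univ.erase i, (M i j : ℂ) * u j := by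
    rw [sub_mul, ← h1]; ring
  have h3 := congrFun hMv i
  simp only [mulVec, dotProduct, Pi.smul_apply, smul_eq_mul] at h3
  rw [← Finset.add_sum_erase _ _ (Finset.mem_univ i)] at h3
  -- Row `i`, where `‖u j‖ / v j` is largest, is compared for the eigenvectors `u` and `v`: the disc
  -- around `M i i` has radius `r - M i i`.
  have h4 : ‖γ - M i i‖ * (m * v i) ≤ (r - M i i) * (m * v i) := by
    calc ‖γ - M i i‖ * (m * v i) = ‖(γ - M i i) * u i‖ := by rw [norm_mul, ← hi]
      _ ≤ ∑ j ∈ Finset.univ.erase i, ‖(M i j : ℂ) * u j‖ := h2 ▸ norm_sum_le _ _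
      _ ≤ ∑ j ∈ Finset.univ.erase i, m * (M i j * v j) := by
        refine Finset.sum_le_sum fun j hj => ?_
        have hMij := hM.offDiag_nonneg i j (Finset.ne_of_mem_erase hj).symm
        rw [norm_mul, Complex.norm_real, Real.norm_of_nonneg hMij]
        calc M i j * ‖u j‖ ≤ M i j * (m * v j) := mul_le_mul_of_nonneg_left (hle j) hMij
          _ = _ := by ring
      _ = (r - M i i) * (m * v i) := by
        rw [← Finset.mul_sum, eq_sub_of_add_eq' h3]; ring
  have h5 := (Complex.re_le_norm _).trans (le_of_mul_le_mul_right h4 hpos)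
  simpa using h5

theorem exists_shift [Nonempty n] (M : Matrix n n ℝ) : ∃ c : ℝ, ∀ i, 0 ≤ M i i + c := by
  obtain ⟨i, hi⟩ := Finite.exists_min fun i => M i i
  exact ⟨-M i i, fun j => by linarith [hi j]⟩

/-- Powers of `M + c` with `c` large enough turn nonzero nonnegative vectors into positive ones. -/
theorem exists_pow_mulVec_pos [DecidableEq n] (hM : IsIrreducibleMetzler M) {c : ℝ}
    (hc : ∀ i, 1 ≤ M i i + c) {w : n → ℝ} (hw : ∀ i, 0 ≤ w i) (hw0 : w ≠ 0) :
    ∃ k : ℕ, ∀ i, 0 < (((M + c • (1 : Matrix n n ℝ)) ^ k) *ᵥ w) i := by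
  classical
  set T := M + c • (1 : Matrix n n ℝ) with hT
  have hT0 : ∀ i j, 0 ≤ T i j := fun i j => by
    rcases eq_or_ne i j with rfl | hij
    · simpa [hT] using zero_le_one.trans (hc i)
    · simpa [hT, hij] using hM.offDiag_nonneg i j hij
  have hTd : ∀ i, 1 ≤ T i i := fun i => by simpa [hT] using hc i
  -- Each application of `T` strictly shrinks the zero set: diagonal entries `≥ 1` keep positive
  -- coordinates positive, and irreducibility gives an edge from a zero coordinate to a positive
  -- one.
  induction hN : (Finset.univ.filter fun i => w i = 0).card using Nat.strong_induction_on
    generalizing w with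
  | _ N ih =>
    by_cases hZ : ∃ i, w i = 0
    · have hcl : ¬ ∀ i ∈ {i | w i = 0}, ∀ j, i ≠ j → 0 < M i j → j ∈ {i | w i = 0} := by
        intro h
        have huniv := hM.eq_univ_of_closed _ hZ h
        exact hw0 (funext fun j => (huniv ▸ mem_univ j : j ∈ {i | w i = 0}))
      push Not at hcl
      obtain ⟨i, hi, j, hij, hMij, hj⟩ := hcl
      have hle : ∀ k, w k ≤ (T *ᵥ w) k := fun k => by
        calc w k ≤ T k k * w k := le_mul_of_one_le_left (hw k) (hTd k)
          _ ≤ _ := Finset.single_le_sum (f := fun j => T k j * w j)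
            (fun j _ => mul_nonneg (hT0 k j) (hw j)) (Finset.mem_univ k)
      have hTi : 0 < (T *ᵥ w) i := by
        have hTij : T i j = M i j := by simp [hT, hij]
        calc 0 < T i j * w j := mul_pos (hTij ▸ hMij) ((hw j).lt_of_ne' hj)
          _ ≤ _ := Finset.single_le_sum (f := fun j => T i j * w j)
            (fun j _ => mul_nonneg (hT0 i j) (hw j)) (Finset.mem_univ j)
      have hlt : (Finset.univ.filter fun k => (T *ᵥ w) k = 0).card < N := by
        rw [← hN]
        refine Finset.card_lt_card (Finset.ssubset_iff_of_subset (fun k hk => ?_) |>.2 ⟨i, ?_, ?_⟩)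
        · have := hle k
          simp only [Finset.mem_filter, Finset.mem_univ, true_and] at hk ⊢
          exact le_antisymm (hk ▸ this) (hw k)
        · simpa using hi
        · simpa using hTi.ne'
      obtain ⟨k, hk⟩ := ih _ hlt (fun k => (hw k).trans (hle k))
        (fun h => hTi.ne' (congrFun h i)) rfl
      refine ⟨k + 1, fun l => ?_⟩
      rw [pow_succ, ← mulVec_mulVec]
      exact hk l
    · push Not at hZ
      exact ⟨0, fun i => by simpa using (hw i).lt_of_ne' (hZ i)⟩

/-- **Perron's theorem** for irreducible Metzler matrices. -/
theorem exists_pos_eigenvector [Nonempty n] (hM : IsIrreducibleMetzler M) :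
    ∃ (r : ℝ) (v : n → ℝ), (∀ i, 0 < v i) ∧ M *ᵥ v = r • v := by
  classical
  obtain ⟨c, hc⟩ := exists_shift M
  set C : ℝ := ∑ i, ∑ j, |M i j| with hC
  have hbd : ∀ (t : ℝ) (v : n → ℝ), v ∈ stdSimplex ℝ n → (∀ i, t * v i ≤ (M *ᵥ v) i) → t ≤ C := by
    intro t v hv hle
    calc t = ∑ i, t * v i := by rw [← Finset.mul_sum, hv.2, mul_one]
      _ ≤ ∑ i, (M *ᵥ v) i := Finset.sum_le_sum fun i _ => hle i
      _ ≤ C := Finset.sum_le_sum fun i _ => Finset.sum_le_sum fun j _ => by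
        have h1 : v j ≤ 1 := hv.2 ▸ Finset.single_le_sum (fun k _ => hv.1 k) (Finset.mem_univ j)
        calc M i j * v j ≤ |M i j| * v j := mul_le_mul_of_nonneg_right (le_abs_self _) (hv.1 j)
          _ ≤ |M i j| := mul_le_of_le_one_right (abs_nonneg _) h1
  -- Collatz–Wielandt: maximise `t` subject to `t v ≤ M v` over the simplex. The bounds on `t` make
  -- the set compact: `C` holds for every admissible `t`, and `-c` is always admissible.
  let K : Set ((n → ℝ) × ℝ) := (stdSimplex ℝ n ×ˢ Icc (-c) C) ∩
    {y | ∀ i, y.2 * y.1 i ≤ (M *ᵥ y.1) i}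
  have hK : IsCompact K := by
    refine ((isCompact_stdSimplex ℝ n).prod isCompact_Icc).inter_right ?_
    simp only [ofPred_forall]
    refine isClosed_iInter fun i => isClosed_le (by fun_prop) ?_
    simp only [mulVec, dotProduct]
    fun_prop
  have hlow : ∀ v : n → ℝ, (∀ i, 0 ≤ v i) → ∀ i, -c * v i ≤ (M *ᵥ v) i := by
    intro v hv i
    have hrest := Finset.sum_nonneg (s := Finset.univ.erase i) (f := fun j => M i j * v j)
      fun j hj => mul_nonneg (hM.offDiag_nonneg i j (Finset.ne_of_mem_erase hj).symm) (hv j)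
    have hsum : (M *ᵥ v) i = M i i * v i + ∑ j ∈ Finset.univ.erase i, M i j * v j :=
      (Finset.add_sum_erase _ (fun j => M i j * v j) (Finset.mem_univ i)).symm
    nlinarith [mul_nonneg (hc i) (hv i)]
  have hKne : K.Nonempty := by
    obtain ⟨i⟩ := ‹Nonempty n›
    have hv := single_mem_stdSimplex ℝ i
    have := hlow _ hv.1
    exact ⟨(Pi.single i 1, -c), ⟨hv, left_mem_Icc.2 (hbd _ _ hv this)⟩, this⟩
  obtain ⟨⟨v, r⟩, ⟨⟨hvs, hr⟩, hle⟩, hmax⟩ := hK.exists_isMaxOn hKne continuous_snd.continuousOn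
  simp only [mem_ofPred_eq] at hle
  have hmax' : ∀ (t : ℝ) (u : n → ℝ), (∀ i, 0 < u i) → (∀ i, t * u i ≤ (M *ᵥ u) i) → t ≤ r := by
    intro t u hu htu
    by_contra! hlt
    have hS : 0 < ∑ i, u i := Finset.sum_pos (fun i _ => hu i) Finset.univ_nonempty
    have hus : (∑ i, u i)⁻¹ • u ∈ stdSimplex ℝ n := by
      refine ⟨fun i => mul_nonneg (inv_nonneg.2 hS.le) (hu i).le, ?_⟩
      simp only [Pi.smul_apply, smul_eq_mul, ← Finset.mul_sum]
      exact inv_mul_cancel₀ hS.ne'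
    have hle' : ∀ i, t * ((∑ i, u i)⁻¹ • u) i ≤ (M *ᵥ ((∑ i, u i)⁻¹ • u)) i := fun i => by
      rw [mulVec_smul]
      simp only [Pi.smul_apply, smul_eq_mul]
      calc t * ((∑ i, u i)⁻¹ * u i) = (∑ i, u i)⁻¹ * (t * u i) := by ring
        _ ≤ _ := mul_le_mul_of_nonneg_left (htu i) (inv_nonneg.2 hS.le)
    have hmem : ((∑ i, u i)⁻¹ • u, t) ∈ K :=
      ⟨⟨hus, hr.1.trans hlt.le, hbd _ _ hus hle'⟩, hle'⟩
    exact absurd (hmax hmem) (not_le.2 hlt)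
  set w := M *ᵥ v - r • v with hw
  have hw0 : ∀ i, 0 ≤ w i := fun i => by simpa [hw] using hle i
  have hv0 : v ≠ 0 := by
    rintro rfl
    simpa using hvs.2
  have heq : w = 0 := by
    by_contra hne
    have hc1 : ∀ i, 1 ≤ M i i + (c + 1) := fun i => by linarith [hc i]
    obtain ⟨k, hk⟩ := hM.exists_pow_mulVec_pos hc1 hw0 hne
    set T := M + (c + 1) • (1 : Matrix n n ℝ) with hT
    have hT0 : ∀ i j, 0 ≤ T i j := fun i j => by
      rcases eq_or_ne i j with rfl | hij
      · simpa [hT] using zero_le_one.trans (hc1 i)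
      · simpa [hT, hij] using hM.offDiag_nonneg i j hij
    obtain ⟨l, hl⟩ := hM.exists_pow_mulVec_pos hc1 hvs.1 hv0
    rw [← hT] at hl
    have hcomm : Commute M T := (Commute.refl M).add_right ((Commute.one_right M).smul_right _)
    have hmon : ∀ (m : ℕ) (u : n → ℝ), (∀ i, 0 < u i) → ∀ i, 0 < ((T ^ m) *ᵥ u) i := by
      intro m
      induction m with
      | zero => intro u hu i; simpa using hu i
      | succ m ih =>
        intro u hu
        rw [pow_succ, ← mulVec_mulVec]
        refine ih _ fun i => ?_
        refine Finset.sum_pos' (fun j _ => mul_nonneg (hT0 i j) (hu j).le)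
          ⟨i, Finset.mem_univ i, mul_pos ?_ (hu i)⟩
        simpa [hT] using zero_lt_one.trans_le (hc1 i)
    set u := (T ^ (k + l)) *ᵥ v with hu
    have hupos : ∀ i, 0 < u i := by
      rw [hu, pow_add, ← mulVec_mulVec]
      exact hmon _ _ hl
    have hMu : M *ᵥ u - r • u = (T ^ (k + l)) *ᵥ w := by
      rw [hu, hw, mulVec_sub, mulVec_smul, mulVec_mulVec, mulVec_mulVec,
        (hcomm.pow_right _).eq]
    have hgap : ∀ i, 0 < (M *ᵥ u - r • u) i := by
      rw [hMu, add_comm k l, pow_add, ← mulVec_mulVec]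
      exact hmon _ _ hk
    obtain ⟨m, i, hmle, hmi⟩ := exists_ratio_max u hgap
    have hm : 0 < m := pos_of_mul_pos_left (hmi ▸ hupos i) (hgap i).le
    have := hmax' (r + m⁻¹) u hupos fun j => by
      have h1 := mul_le_mul_of_nonneg_left (hmle j) (inv_nonneg.2 hm.le)
      rw [← mul_assoc, inv_mul_cancel₀ hm.ne', one_mul] at h1
      simp only [Pi.sub_apply, Pi.smul_apply, smul_eq_mul] at h1
      linarith
    linarith [inv_pos.2 hm]
  have hMv : M *ᵥ v = r • v := sub_eq_zero.1 heq
  refine ⟨r, v, fun i => (hvs.1 i).lt_of_ne' fun hi => hv0 ?_, hMv⟩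
  exact hM.eq_zero_of_mulVec_le (t := r) hvs.1 (fun j => by simp [hMv]) hi

end IsIrreducibleMetzler

end Perron

/-! ### The Perron pair of `A_p`: smoothness and derivative at zero -/

variable {E : Type*} [Fintype E] [DecidableEq E] {A : Matrix E E ℝ}

theorem tilted_apply_of_ne {E : Type*} [DecidableEq E] (A : Matrix E E ℝ) (lam : E → ℝ) (p : ℝ)
    {x y : E} (h : x ≠ y) : tilted A lam p x y = A x y := by
  simp [tilted, h]

theorem tilted_mulVec (A : Matrix E E ℝ) (lam : E → ℝ) (p : ℝ) (v : E → ℝ) (x : E) :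
    (tilted A lam p *ᵥ v) x = (A *ᵥ v) x - p * (lam x * v x) := by
  simp [tilted, sub_mulVec, smul_mulVec, mulVec_diagonal]

theorem IsGenerator.pos_of_embeddedChain_pos (hA : IsGenerator A) {x y : E}
    (h : 0 < embeddedChain A x y) : x ≠ y ∧ 0 < A x y := by
  have hxy : x ≠ y := by
    rintro rfl
    simp [embeddedChain] at h
  refine ⟨hxy, (hA.offDiag_nonneg x y hxy).lt_of_ne' fun h0 => ?_⟩
  simp [embeddedChain, h0] at h

theorem IsGenerator.jumpRate_pos [Nontrivial E] (hA : IsGenerator A)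
    (hP : (embeddedChain A).IsIrreducible) (x : E) : 0 < jumpRate A x := by
  obtain ⟨y, hy⟩ := hP.exists_pos x
  obtain ⟨hxy, hpos⟩ := hA.pos_of_embeddedChain_pos hy
  have h := hA.row_sum_eq_zero x
  rw [← Finset.add_sum_erase _ _ (Finset.mem_univ x)] at h
  have := Finset.single_le_sum (s := Finset.univ.erase x) (f := fun j => A x j)
    (fun j hj => hA.offDiag_nonneg x j (Finset.ne_of_mem_erase hj).symm)
    (Finset.mem_erase.2 ⟨hxy.symm, Finset.mem_univ y⟩)
  simp only [jumpRate]
  linarith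

theorem IsGenerator.isIrreducibleMetzler_tilted (hA : IsGenerator A)
    (hP : (embeddedChain A).IsIrreducible) (lam : E → ℝ) (p : ℝ) :
    IsIrreducibleMetzler (tilted A lam p) := by
  refine ⟨fun x y h => tilted_apply_of_ne A lam p h ▸ hA.offDiag_nonneg x y h,
    fun Z ⟨x, hx⟩ hZ => eq_univ_of_forall fun y => ?_⟩
  let := toQuiver (embeddedChain A)
  obtain ⟨path, -⟩ := hP.connected x y
  induction path with
  | nil => exact hx
  | cons _ e ih =>
    obtain ⟨hne, hpos⟩ := hA.pos_of_embeddedChain_pos e.down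
    exact hZ _ ih _ hne (tilted_apply_of_ne A lam p hne ▸ hpos)

/-- `-η_p` is the eigenvalue of any positive eigenvector of `A_p`. -/
theorem eta_eq_neg [Nonempty E] {lam : E → ℝ} {p : ℝ}
    (hM : IsIrreducibleMetzler (tilted A lam p)) {r : ℝ} {v : E → ℝ} (hv : ∀ x, 0 < v x)
    (h : tilted A lam p *ᵥ v = r • v) : eta A lam p = -r := by
  obtain ⟨⟨γ, hγ, hγre⟩, hub⟩ := isGreatest_spectralReals A lam p
  have h1 : -eta A lam p ≤ r := hγre ▸ hM.re_le_of_mem_spectrum hv h hγ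
  have h2 : r ≤ -eta A lam p := by
    refine hub ⟨(r : ℂ), ?_, Complex.ofReal_re r⟩
    rw [← Matrix.spectrum_toLin', ← Module.End.hasEigenvalue_iff_mem_spectrum]
    refine Module.End.hasEigenvalue_of_hasEigenvector (x := fun x => (v x : ℂ))
      ⟨Module.End.mem_eigenspace_iff.2 ?_, fun h0 => ?_⟩
    · funext x
      have := congrArg (fun t : ℝ => (t : ℂ)) (congrFun h x)
      simpa [mulVec, dotProduct] using this
    · obtain ⟨x⟩ := ‹Nonempty E›
      have := congrFun h0 x
      exact (hv x).ne' (by simpa using this)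
  linarith

theorem exists_pos_eigenvector_tilted [Nonempty E] (hA : IsGenerator A)
    (hP : (embeddedChain A).IsIrreducible) (lam : E → ℝ) (p : ℝ) :
    ∃ v : E → ℝ, (∀ x, 0 < v x) ∧ tilted A lam p *ᵥ v = (-eta A lam p) • v := by
  have hM := hA.isIrreducibleMetzler_tilted hP lam p
  obtain ⟨r, v, hv, h⟩ := hM.exists_pos_eigenvector
  exact ⟨v, hv, by rw [eta_eq_neg hM hv h, neg_neg, h]⟩

/-- Smooth continuation of the positive eigenvector near `p`. -/
theorem exists_contDiffAt_eigenvector [Nonempty E] {lam : E → ℝ} {p : ℝ}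
    (hM : IsIrreducibleMetzler (tilted A lam p)) {r : ℝ} {v : E → ℝ} (hv : ∀ x, 0 < v x)
    (h : tilted A lam p *ᵥ v = r • v) :
    ∃ (V : ℝ → E → ℝ) (R : ℝ → ℝ), ContDiffAt ℝ ∞ V p ∧ ContDiffAt ℝ ∞ R p ∧ V p = v ∧
      ∀ᶠ q in 𝓝 p, (∀ x, 0 < V q x) ∧ tilted A lam q *ᵥ V q = R q • V q := by
  let LA : (E → ℝ) →L[ℝ] (E → ℝ) := LinearMap.toContinuousLinearMap (toLin' A)
  let LL : (E → ℝ) →L[ℝ] (E → ℝ) := LinearMap.toContinuousLinearMap (toLin' (diagonal lam))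
  let S : (E → ℝ) →L[ℝ] ℝ := ∑ x, ContinuousLinearMap.proj x
  -- The eigenvector equation together with the coordinate sum, which fixes the scaling; without it
  -- the linearisation would have `v` in its kernel.
  let f : ℝ × ((E → ℝ) × ℝ) → (E → ℝ) × ℝ := fun u =>
    (LA u.2.1 - u.1 • LL u.2.1 - u.2.2 • u.2.1, S u.2.1)
  have hf_tilted : ∀ q w, LA w - q • LL w = tilted A lam q *ᵥ w := fun q w => by
    simp [LA, LL, tilted, sub_mulVec, smul_mulVec]
  have hf : ContDiff ℝ ∞ f := by fun_prop
  let D : ((E → ℝ) × ℝ) →L[ℝ] (E → ℝ) × ℝ :=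
    ((LA - p • LL - r • ContinuousLinearMap.id ℝ (E → ℝ)) ∘L ContinuousLinearMap.fst ℝ _ _ -
      (ContinuousLinearMap.snd ℝ (E → ℝ) ℝ).smulRight v).prod (S ∘L ContinuousLinearMap.fst ℝ _ _)
  have hDapply : ∀ w s, D (w, s) = (tilted A lam p *ᵥ w - r • w - s • v, ∑ x, w x) := fun w s => by
    simp [D, S, ← hf_tilted]
  -- Simplicity of the eigenvalue leaves only multiples of `v`, and the sum condition excludes the
  -- nonzero ones.
  have hinj : Function.Injective D.toLinearMap := by
    rw [injective_iff_map_eq_zero]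
    rintro ⟨w, s⟩ hws
    have hws' : D (w, s) = 0 := hws
    rw [hDapply, Prod.mk_eq_zero, sub_eq_zero] at hws'
    obtain ⟨rfl, m, rfl⟩ := hM.eq_smul_of_mulVec_sub_eq hv h hws'.1
    have hs := hws'.2
    simp only [Pi.smul_apply, smul_eq_mul, ← Finset.mul_sum] at hs
    have hpos : 0 < ∑ x, v x := Finset.sum_pos (fun x _ => hv x) Finset.univ_nonempty
    rcases mul_eq_zero.1 hs with rfl | h0
    · simp
    · exact absurd h0 hpos.ne'
  have hD : D.IsInvertible :=
    ⟨(LinearEquiv.ofInjectiveEndo D.toLinearMap hinj).toContinuousLinearEquiv, by ext <;> rfl⟩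
  have hfd : fderiv ℝ f (p, (v, r)) ∘L .inr ℝ ℝ ((E → ℝ) × ℝ) = D := by
    have h1 : HasFDerivAt (fun y => f (p, y))
        (fderiv ℝ f (p, (v, r)) ∘L .inr ℝ ℝ ((E → ℝ) × ℝ)) (v, r) :=
      ((hf.differentiable (by simp)) (p, (v, r))).hasFDerivAt.comp (v, r)
        (hasFDerivAt_prodMk_right p (v, r))
    refine h1.unique ?_
    have hfst : HasFDerivAt (fun y : (E → ℝ) × ℝ => y.1) (.fst ℝ (E → ℝ) ℝ) (v, r) :=
      hasFDerivAt_fst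
    have hsnd : HasFDerivAt (fun y : (E → ℝ) × ℝ => y.2) (.snd ℝ (E → ℝ) ℝ) (v, r) :=
      hasFDerivAt_snd
    have h2 : HasFDerivAt (fun y : (E → ℝ) × ℝ => (LA - p • LL) y.1 - y.2 • y.1)
        ((LA - p • LL) ∘L ContinuousLinearMap.fst ℝ _ _ -
          (r • ContinuousLinearMap.fst ℝ (E → ℝ) ℝ +
            (ContinuousLinearMap.snd ℝ (E → ℝ) ℝ).smulRight v)) (v, r) :=
      ((LA - p • LL).hasFDerivAt.comp (v, r) hfst).fun_sub (hsnd.fun_smul hfst)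
    have h3 : HasFDerivAt (fun y : (E → ℝ) × ℝ => S y.1) (S ∘L ContinuousLinearMap.fst ℝ _ _)
        (v, r) := S.hasFDerivAt.comp (v, r) hfst
    convert! h2.prodMk h3 using 1
    ext <;> simp [D]
  have cdf : ContDiffAt ℝ ∞ f (p, (v, r)) := hf.contDiffAt
  have hinv : (fderiv ℝ f (p, (v, r)) ∘L .inr ℝ ℝ ((E → ℝ) × ℝ)).IsInvertible := hfd ▸ hD
  have hn : (∞ : WithTop ℕ∞) ≠ 0 := by simp
  set ψ := cdf.implicitFunction hn hinv with hψ
  have hψs : ContDiffAt ℝ ∞ ψ p := cdf.contDiffAt_implicitFunction hn hinv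
  have hψp : ψ p = (v, r) := cdf.implicitFunction_apply_self hn hinv
  have hψe := cdf.eventually_apply_implicitFunction hn hinv
  refine ⟨fun q => (ψ q).1, fun q => (ψ q).2, hψs.fst, hψs.snd, by simp [hψp], ?_⟩
  have hpos : ∀ᶠ q in 𝓝 p, ∀ x, 0 < (ψ q).1 x := by
    refine eventually_all.2 fun x => ?_
    have hc : ContinuousAt (fun q => (ψ q).1 x) p :=
      (continuous_apply x).continuousAt.comp hψs.fst.continuousAt
    exact hc.eventually_const_lt (by simpa [hψp] using hv x)
  filter_upwards [hpos, hψe] with q hq1 hq2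
  refine ⟨hq1, ?_⟩
  have h4 : LA (ψ q).1 - q • LL (ψ q).1 - (ψ q).2 • (ψ q).1 = LA v - p • LL v - r • v :=
    congrArg Prod.fst hq2
  rw [hf_tilted, hf_tilted, h, sub_self] at h4
  exact sub_eq_zero.1 h4

theorem contDiff_eta [Nonempty E] (hA : IsGenerator A) (hP : (embeddedChain A).IsIrreducible)
    (lam : E → ℝ) : ContDiff ℝ ∞ (eta A lam) := by
  refine contDiff_iff_contDiffAt.2 fun p => ?_
  obtain ⟨v, hv, h⟩ := exists_pos_eigenvector_tilted hA hP lam p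
  obtain ⟨V, R, -, hR, -, hev⟩ :=
    exists_contDiffAt_eigenvector (hA.isIrreducibleMetzler_tilted hP lam p) hv h
  refine hR.neg.congr_of_eventuallyEq ?_
  filter_upwards [hev] with q hq
  exact eta_eq_neg (hA.isIrreducibleMetzler_tilted hP lam q) hq.1 hq.2

theorem eta_zero [Nonempty E] (hA : IsGenerator A) (hP : (embeddedChain A).IsIrreducible)
    (lam : E → ℝ) : eta A lam 0 = 0 := by
  have := eta_eq_neg (hA.isIrreducibleMetzler_tilted hP lam 0) (r := 0) (v := fun _ => 1)
    (fun _ => one_pos) (by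
      funext x
      rw [tilted_mulVec]
      simp [mulVec, dotProduct, hA.row_sum_eq_zero])
  simpa using this

/-- Since `μ A = 0`, pairing the eigenvector equation with `μ` expresses `η_q / q` as a weighted
mean of `lam` with weights `μ x * V q x`. Continuity of `V` at `0`, where it equals `1`, suffices to
pass to the limit. -/
theorem hasDerivAt_eta_zero [Nonempty E] (hA : IsGenerator A)
    (hP : (embeddedChain A).IsIrreducible) {μ : E → ℝ} (hμ : IsInvariantProbability A μ)
    (lam : E → ℝ) : HasDerivAt (eta A lam) (∑ x, lam x * μ x) 0 := by
  have h1 : tilted A lam 0 *ᵥ (fun _ => 1) = (0 : ℝ) • fun _ : E => (1 : ℝ) := by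
    funext x
    rw [tilted_mulVec]
    simp [mulVec, dotProduct, hA.row_sum_eq_zero]
  obtain ⟨V, R, hV, -, hV0, hev⟩ := exists_contDiffAt_eigenvector
    (hA.isIrreducibleMetzler_tilted hP lam 0) (fun _ => one_pos) h1
  have hc : ∀ x, Tendsto (fun q => V q x) (𝓝 0) (𝓝 1) := fun x => by
    have : ContinuousAt (fun q => V q x) 0 :=
      (continuous_apply x).continuousAt.comp hV.continuousAt
    simpa [ContinuousAt, hV0] using this
  have hlim : Tendsto (fun q => (∑ x, lam x * μ x * V q x) / ∑ x, μ x * V q x) (𝓝[≠] 0)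
      (𝓝 (∑ x, lam x * μ x)) := by
    have hnum : Tendsto (fun q => ∑ x, lam x * μ x * V q x) (𝓝 0) (𝓝 (∑ x, lam x * μ x * 1)) :=
      tendsto_finsetSum _ fun x _ => (hc x).const_mul _
    have hden : Tendsto (fun q => ∑ x, μ x * V q x) (𝓝 0) (𝓝 (∑ x, μ x * 1)) :=
      tendsto_finsetSum _ fun x _ => (hc x).const_mul _
    simp only [mul_one, hμ.1.2] at hnum hden
    have h := (hnum.div hden one_ne_zero).mono_left (nhdsWithin_le_nhds (s := {0}ᶜ))
    rwa [div_one] at h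
  rw [hasDerivAt_iff_tendsto_slope]
  refine hlim.congr' ?_
  filter_upwards [hev.filter_mono nhdsWithin_le_nhds, self_mem_nhdsWithin] with q ⟨hq, hq'⟩ hq0
  have hq0 : q ≠ 0 := hq0
  have hR := eta_eq_neg (hA.isIrreducibleMetzler_tilted hP lam q) hq hq'
  have hden : 0 < ∑ x, μ x * V q x := by
    obtain ⟨x, -, hx⟩ : ∃ x ∈ Finset.univ, 0 < μ x :=
      (Finset.sum_pos_iff_of_nonneg fun x _ => hμ.1.1 x).1 (hμ.1.2 ▸ one_pos)
    exact Finset.sum_pos' (fun y _ => mul_nonneg (hμ.1.1 y) (hq y).le)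
      ⟨x, Finset.mem_univ x, mul_pos hx (hq x)⟩
  have hkey : eta A lam q * ∑ x, μ x * V q x = q * ∑ x, lam x * μ x * V q x := by
    have h2 : ∑ x, μ x * (A *ᵥ V q) x = 0 := by
      change μ ⬝ᵥ (A *ᵥ V q) = 0
      rw [dotProduct_mulVec, hμ.2, zero_dotProduct]
    have h3 : ∀ x, μ x * (A *ᵥ V q) x =
        q * (lam x * μ x * V q x) - eta A lam q * (μ x * V q x) := fun x => by
      have := congrFun hq' x
      rw [tilted_mulVec, ← neg_eq_iff_eq_neg.2 hR] at this
      simp only [Pi.smul_apply, smul_eq_mul] at this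
      rw [sub_eq_iff_eq_add.1 this]
      ring
    simp only [h3, Finset.sum_sub_distrib, ← Finset.mul_sum] at h2
    linarith
  rw [slope_def_field, eta_zero hA hP, sub_zero, sub_zero, div_eq_div_iff hden.ne' hq0, hkey]
  ring

/-! ### Concavity, bounds and behaviour at infinity -/

/-- Weighted geometric means of positive eigenvectors are supersolutions. -/
theorem tilted_mulVec_geom_mean_le (hA : IsGenerator A) {lam : E → ℝ} {p q r s a b : ℝ}
    {v w : E → ℝ} (hv : ∀ x, 0 < v x) (hw : ∀ x, 0 < w x) (hpv : tilted A lam p *ᵥ v = r • v)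
    (hqw : tilted A lam q *ᵥ w = s • w) (ha : 0 ≤ a) (hb : 0 ≤ b) (hab : a + b = 1) (x : E) :
    (tilted A lam (a * p + b * q) *ᵥ fun y => v y ^ a * w y ^ b) x ≤
      (a * r + b * s) * (v x ^ a * w x ^ b) := by
  set u : E → ℝ := fun y => v y ^ a * w y ^ b with hu
  have hux : 0 < u x := mul_pos (Real.rpow_pos_of_pos (hv x) a) (Real.rpow_pos_of_pos (hw x) b)
  have hratio : ∀ y, u y ≤ u x * (a * (v y / v x) + b * (w y / w x)) := fun y => by
    have h := Real.geom_mean_le_arith_mean2_weighted ha hb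
      (div_pos (hv y) (hv x)).le (div_pos (hw y) (hw x)).le hab
    rw [Real.div_rpow (hv y).le (hv x).le, Real.div_rpow (hw y).le (hw x).le,
      div_mul_div_comm, div_le_iff₀' hux] at h
    exact h
  have hterm : ∀ y, A x y * u y ≤
      u x * (a / v x) * (A x y * v y) + u x * (b / w x) * (A x y * w y) := fun y => by
    rcases eq_or_ne x y with rfl | hxy
    -- On the diagonal `A x y` may be negative, but there both sides agree because `a + b = 1`.
    · refine le_of_eq ?_
      have h1 := (hv x).ne'
      have h2 := (hw x).ne'
      field_simp
      rw [hab, mul_one]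
    · calc A x y * u y ≤ A x y * (u x * (a * (v y / v x) + b * (w y / w x))) :=
          mul_le_mul_of_nonneg_left (hratio y) (hA.offDiag_nonneg x y hxy)
        _ = _ := by ring
  have hsum : (A *ᵥ u) x ≤ u x * (a / v x) * (A *ᵥ v) x + u x * (b / w x) * (A *ᵥ w) x := by
    simp only [mulVec, dotProduct]
    rw [Finset.mul_sum, Finset.mul_sum, ← Finset.sum_add_distrib]
    exact Finset.sum_le_sum fun y _ => hterm y
  have hvx := congrFun hpv x
  have hwx := congrFun hqw x
  rw [tilted_mulVec, sub_eq_iff_eq_add] at hvx hwx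
  simp only [Pi.smul_apply, smul_eq_mul] at hvx hwx
  rw [hvx, hwx] at hsum
  rw [tilted_mulVec]
  have h1 : a / v x * v x = a := div_mul_cancel₀ _ (hv x).ne'
  have h2 : b / w x * w x = b := div_mul_cancel₀ _ (hw x).ne'
  calc (A *ᵥ u) x - (a * p + b * q) * (lam x * u x)
      ≤ u x * (a / v x * v x) * (r + p * lam x) + u x * (b / w x * w x) * (s + q * lam x)
        - (a * p + b * q) * (lam x * u x) := by linarith
    _ = (a * r + b * s) * u x := by rw [h1, h2]; ring

theorem concaveOn_eta [Nonempty E] (hA : IsGenerator A) (hP : (embeddedChain A).IsIrreducible)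
    (lam : E → ℝ) : ConcaveOn ℝ univ (eta A lam) := by
  refine ⟨convex_univ, fun p _ q _ a b ha hb hab => ?_⟩
  obtain ⟨v, hv, hpv⟩ := exists_pos_eigenvector_tilted hA hP lam p
  obtain ⟨w, hw, hqw⟩ := exists_pos_eigenvector_tilted hA hP lam q
  obtain ⟨z, hz, hpz⟩ := exists_pos_eigenvector_tilted hA hP lam (a * p + b * q)
  have := (hA.isIrreducibleMetzler_tilted hP lam (a * p + b * q)).le_of_mulVec_le hz hpz
    (fun y => mul_pos (Real.rpow_pos_of_pos (hv y) a) (Real.rpow_pos_of_pos (hw y) b))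
    (tilted_mulVec_geom_mean_le hA hv hw hpv hqw ha hb hab)
  simp only [smul_eq_mul]
  linarith

/-- In row `x` of the eigenvector equation the off-diagonal part is strictly positive, since some
jump leaves `x`. This strictness keeps `κ` below `criticalBound`. -/
theorem eta_lt [Nontrivial E] (hA : IsGenerator A) (hP : (embeddedChain A).IsIrreducible)
    (lam : E → ℝ) (p : ℝ) (x : E) : eta A lam p < jumpRate A x + p * lam x := by
  obtain ⟨v, hv, h⟩ := exists_pos_eigenvector_tilted hA hP lam p
  have hx := congrFun h x
  rw [tilted_mulVec] at hx
  simp only [mulVec, dotProduct, Pi.smul_apply, smul_eq_mul] at hx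
  rw [← Finset.add_sum_erase _ _ (Finset.mem_univ x)] at hx
  obtain ⟨y, hy⟩ := hP.exists_pos x
  obtain ⟨hxy, hpos⟩ := hA.pos_of_embeddedChain_pos hy
  have hsum : 0 < ∑ j ∈ Finset.univ.erase x, A x j * v j :=
    Finset.sum_pos' (fun j hj => mul_nonneg
      (hA.offDiag_nonneg x j (Finset.ne_of_mem_erase hj).symm) (hv j).le)
      ⟨y, Finset.mem_erase.2 ⟨hxy.symm, Finset.mem_univ y⟩, mul_pos hpos (hv y)⟩
  refine lt_of_mul_lt_mul_right ?_ (hv x).le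
  simp only [jumpRate]
  nlinarith

/-- The constant vector `1` is a supersolution of `A_p`, because `A` annihilates it. -/
theorem mul_minRate_le_eta [Nonempty E] (hA : IsGenerator A)
    (hP : (embeddedChain A).IsIrreducible) (lam : E → ℝ) {p : ℝ} (hp : 0 ≤ p) :
    p * minRate lam ≤ eta A lam p := by
  obtain ⟨v, hv, h⟩ := exists_pos_eigenvector_tilted hA hP lam p
  have := (hA.isIrreducibleMetzler_tilted hP lam p).le_of_mulVec_le hv h
    (u := fun _ => 1) (t := -(p * minRate lam)) (fun _ => one_pos) fun x => by
      have h1 : minRate lam ≤ lam x := Finset.inf'_le _ (Finset.mem_univ x)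
      rw [tilted_mulVec]
      simpa [mulVec, dotProduct, hA.row_sum_eq_zero] using mul_le_mul_of_nonneg_left h1 hp
  linarith

theorem tendsto_eta_div_atTop [Nontrivial E] (hA : IsGenerator A)
    (hP : (embeddedChain A).IsIrreducible) (lam : E → ℝ) :
    Tendsto (fun p : ℝ => eta A lam p / p) atTop (𝓝 (minRate lam)) := by
  obtain ⟨x, -, hx⟩ := Finset.exists_mem_eq_inf' Finset.univ_nonempty lam
  have hx : minRate lam = lam x := hx
  have hup : Tendsto (fun p : ℝ => jumpRate A x / p + minRate lam) atTop (𝓝 (minRate lam)) := by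
    simpa using (tendsto_const_nhds.div_atTop tendsto_id).add_const (minRate lam)
  refine tendsto_of_tendsto_of_tendsto_of_le_of_le' tendsto_const_nhds hup ?_ ?_
  · filter_upwards [eventually_gt_atTop 0] with p hp
    rw [le_div_iff₀' hp]
    exact mul_minRate_le_eta hA hP lam hp.le
  · filter_upwards [eventually_gt_atTop 0] with p hp
    rw [div_le_iff₀ hp, add_mul, div_mul_cancel₀ _ hp.ne', hx, mul_comm (lam x)]
    exact (eta_lt hA hP lam p x).le

/-! ### Signs of `η` and the critical exponent -/

/-- A concave function that is positive at `q` and nonnegative at `s` is positive in between. -/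
theorem pos_of_concaveOn {f : ℝ → ℝ} (hf : ConcaveOn ℝ univ f) {q p s : ℝ} (hq : 0 < f q)
    (hs : 0 ≤ f s) (hqp : q ≤ p) (hps : p < s) : 0 < f p := by
  have hsq : 0 < s - q := by linarith
  have h := hf.2 (mem_univ q) (mem_univ s)
    (div_nonneg (sub_nonneg.2 hps.le) hsq.le) (div_nonneg (sub_nonneg.2 hqp) hsq.le)
    (by rw [← add_div, div_eq_one_iff_eq hsq.ne']; ring)
  have hp : ((s - p) / (s - q)) • q + ((p - q) / (s - q)) • s = p := by
    simp only [smul_eq_mul]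
    field_simp
    ring
  rw [hp] at h
  refine lt_of_lt_of_le ?_ h
  exact add_pos_of_pos_of_nonneg (mul_pos (div_pos (by linarith) hsq) hq)
    (mul_nonneg (div_nonneg (by linarith) hsq.le) hs)

theorem exists_pos_of_hasDerivAt_zero {f : ℝ → ℝ} {m : ℝ} (hf : HasDerivAt f m 0) (h0 : f 0 = 0)
    (hm : 0 < m) {p : ℝ} (hp : 0 < p) : ∃ q, 0 < q ∧ q < p ∧ 0 < f q := by
  have h1 := (hasDerivAt_iff_tendsto_slope.1 hf).eventually_const_lt hm
  have h2 := h1.filter_mono (nhdsGT_le_nhdsNE (0 : ℝ))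
  obtain ⟨q, hq, hq0, hqp⟩ := (h2.and (Ioo_mem_nhdsGT hp)).exists
  refine ⟨q, hq0, hqp, ?_⟩
  rw [slope_def_field, h0, sub_zero, sub_zero] at hq
  exact (div_pos_iff_of_pos_right hq0).1 hq

theorem eta_pos_of_minRate_nonneg [Nonempty E] (hA : IsGenerator A)
    (hP : (embeddedChain A).IsIrreducible) {μ : E → ℝ} (hμ : IsInvariantProbability A μ)
    {lam : E → ℝ} (hm : 0 < ∑ x, lam x * μ x) (hlam : 0 ≤ minRate lam) {p : ℝ} (hp : 0 < p) :
    0 < eta A lam p := by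
  obtain ⟨q, -, hqp, hq⟩ := exists_pos_of_hasDerivAt_zero (hasDerivAt_eta_zero hA hP hμ lam)
    (eta_zero hA hP lam) hm hp
  -- Any point beyond `p` would serve as the right end for concavity.
  have hs : 0 ≤ p + 1 := by linarith
  exact pos_of_concaveOn (concaveOn_eta hA hP lam) hq
    ((mul_nonneg hs hlam).trans (mul_minRate_le_eta hA hP lam hs)) hqp.le (lt_add_one p)

theorem existsUnique_eta_sign_change [Nontrivial E] (hA : IsGenerator A)
    (hP : (embeddedChain A).IsIrreducible) {μ : E → ℝ} (hμ : IsInvariantProbability A μ)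
    {lam : E → ℝ} (hm : 0 < ∑ x, lam x * μ x) (hlam : minRate lam < 0) :
    ∃! κ : ℝ, κ ∈ Ioo 0 (criticalBound A lam) ∧
      (∀ p : ℝ, 0 < p → p < κ → 0 < eta A lam p) ∧ (∀ p : ℝ, κ < p → eta A lam p < 0) := by
  have hconc := concaveOn_eta hA hP lam
  have hsmall : ∀ {p : ℝ}, 0 < p → ∃ q, 0 < q ∧ q < p ∧ 0 < eta A lam q :=
    exists_pos_of_hasDerivAt_zero (hasDerivAt_eta_zero hA hP hμ lam) (eta_zero hA hP lam) hm
  obtain ⟨⟨x, (hx : lam x < 0), hxb⟩, -⟩ := isLeast_criticalBound A lam hlam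
  set b := criticalBound A lam with hb
  have hxb : b * lam x = -jumpRate A x := by rw [← hxb]; exact div_mul_cancel₀ _ hx.ne
  have hb0 : 0 < b := by
    have := hA.jumpRate_pos hP x
    by_contra! h
    nlinarith
  -- At the minimising `x`, the upper bound `a(x) + b * lam x` is exactly zero.
  have hetab : eta A lam b < 0 := by
    have := eta_lt hA hP lam b x
    rwa [hxb, add_neg_cancel] at this
  obtain ⟨q, hq0, hqb, hq⟩ := hsmall hb0
  obtain ⟨κ, ⟨hqκ, hκb⟩, hκ⟩ := intermediate_value_Ioo' hqb.le
    (contDiff_eta hA hP lam).continuous.continuousOn (mem_Ioo.2 ⟨hetab, hq⟩)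
  have hκ0 : 0 < κ := hq0.trans hqκ
  refine ⟨κ, ⟨⟨hκ0, hκb⟩, fun p hp hpκ => ?_, fun p hp => ?_⟩, ?_⟩
  · obtain ⟨s, -, hsp, hs⟩ := hsmall hp
    exact pos_of_concaveOn hconc hs hκ.ge hsp.le hpκ
  -- A nonnegative value at `p > κ` and the positive one at `q < κ` would force `η_κ > 0`.
  · by_contra! h
    exact (pos_of_concaveOn hconc hq h hqκ.le hp).ne' hκ
  · rintro κ' ⟨⟨hκ'0, -⟩, hpos, hneg⟩
    rcases lt_trichotomy κ' κ with h | h | h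
    · exact absurd hκ (hneg κ h).ne
    · exact h
    · exact absurd hκ (hpos κ hκ0 h).ne'

end SwitchedOU

theorem mainTheorem6 {E : Type*} [Fintype E] [DecidableEq E] [Nontrivial E]
    (A : Matrix E E ℝ) (hA : SwitchedOU.IsGenerator A)
    (hP : (SwitchedOU.embeddedChain A).IsIrreducible)
    (μ : E → ℝ) (hμ : SwitchedOU.IsInvariantProbability A μ)
    (lam : E → ℝ) :
    ContDiffOn ℝ ∞ (SwitchedOU.eta A lam) (Ici 0) ∧
    ConcaveOn ℝ (Ici 0) (SwitchedOU.eta A lam) ∧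
    HasDerivAt (SwitchedOU.eta A lam) (∑ x, lam x * μ x) 0 ∧
    Tendsto (fun p : ℝ => SwitchedOU.eta A lam p / p) atTop (𝓝 (SwitchedOU.minRate lam)) ∧
    (0 < ∑ x, lam x * μ x →
      (0 ≤ SwitchedOU.minRate lam → ∀ p : ℝ, 0 < p → 0 < SwitchedOU.eta A lam p) ∧
      (SwitchedOU.minRate lam < 0 →
        ∃! κ : ℝ, κ ∈ Ioo 0 (SwitchedOU.criticalBound A lam) ∧
          (∀ p : ℝ, 0 < p → p < κ → 0 < SwitchedOU.eta A lam p) ∧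
          (∀ p : ℝ, κ < p → SwitchedOU.eta A lam p < 0))) := by
  exact ⟨(SwitchedOU.contDiff_eta hA hP lam).contDiffOn,
    (SwitchedOU.concaveOn_eta hA hP lam).subset (subset_univ _) (convex_Ici 0),
    SwitchedOU.hasDerivAt_eta_zero hA hP hμ lam, SwitchedOU.tendsto_eta_div_atTop hA hP lam,
    fun hm => ⟨fun hlam _ hp => SwitchedOU.eta_pos_of_minRate_nonneg hA hP hμ hm hlam hp,
      SwitchedOU.existsUnique_eta_sign_change hA hP hμ hm⟩⟩
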